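/- Let $X\subseteq\mathbb{R}^n$, let $\Xi\subseteq\mathbb{R}^d$ be an arbitrary set, let $\|\cdot\|$ be an arbitrary norm on $\mathbb{R}^d$ with $d(s,s')=\|s-s'\|$, and let $\mathcal F$ be a $\sigma$-algebra on $\Xi$ that contains the Borel sets of $\Xi$. Let $f,r:\mathbb{R}^n\to\mathbb{R}$ and $h:\mathbb{R}^n\times\Xi\to\mathbb{R}$ be such that for every $x\in X$ the function $h(x,\cdot)$ is $\mathcal F$-measurable and $r(x)\ge 0$. Let $N\ge 1$, let $\xi^1,\dots,\xi^N\in\Xi$, and let $P_0=\frac1N\sum_{i=1}^N\delta_{\xi^i}$. For probability measures $P_1,P_2$ on $(\Xi,\mathcal F)$ let $\mathcal W(P_1,P_2)=\inf_K\int_{\Xi\times\Xi}\|s_1-s_2\|\,K(ds_1\times ds_2)\in[0,\infty]$, the infimum being over all probability measures $K$ on $\Xi\times\Xi$ with marginals $P_1$ and $P_2$. For $x\in X$ put $\mathcal P(x)=\{P \text{ a probability measure on }(\Xi,\mathcal F):\ \mathcal W(P,P_0)\le r(x)\}$. If $r(x)=0$ for some $x\in X$, assume for this $x$ that $h(x,\cdot)$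 is upper semicontinuous at each $\xi^i$ and that $h(x,s)\le C(1+\|s\|)$ for all $s\in\Xi$, with some constant $C$; where $r(x)>0$ nothing more is assumed. Consider the decision dependent distributionally robust problem $$(\mathrm{D^3RO})\qquad \inf_{x\in X}\Big\{F(x):=f(x)+\sup_{P\in\mathcal P(x)}\mathbb{E}_P[h(x,\xi)]\Big\}$$ (expectations take values in $[-\infty,\infty]$, as the expectation of the positive part minus that of the negative part, with $\infty-\infty=-\infty$) and the semi-infinite program $$(\mathrm{SIP})\qquad \begin{aligned}\inf_{x,v}\ & f(x)+\tfrac1N\sum_{i=1}^N v_i+r(x)\,v_{N+1}\\ \text{s.t. }& h(x,s)-v_i-v_{N+1}\,d(s,\xi^i)\le 0\quad\forall s\in\Xi,\ \forall i\in\{1,\dots,N\},\\ & x\in X,\ v_1,\dots,v_N\in\mathbb{R},\ v_{N+1}\ge 0.\end{aligned}$$ Then $(\mathrm{D^3RO})$ can be reformulated as $(\mathrm{SIP})$, that is: 1. the two problems have the same optimal value in $[-\infty,\infty]$ (the infimum over an empty set being $+\infty$); 2. for every $x\in X$, $F(x)$ equals the infimum of the objective of $(\mathrm{SIP})$ over all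 $v$ for which $(x,v)$ is feasible; 3. if $(x,v)$ is an optimal solution of $(\mathrm{SIP})$, then $x$ is an optimal solution of $(\mathrm{D^3RO})$ with $F(x)<\infty$; conversely, if $x$ is an optimal solution of $(\mathrm{D^3RO})$ with $F(x)<\infty$ and $r(x)>0$, then there is $v$ such that $(x,v)$ is an optimal solution of $(\mathrm{SIP})$. -/

import Mathlib

open MeasureTheory
open scoped ENNReal

noncomputable section

namespace D3RO

/-- Joint probability distributions on `Ξ × Ξ` with marginals `P₁` and `P₂`. -/
def couplings {Ξ : Type*} [MeasurableSpace Ξ] (P₁ P₂ : Measure Ξ) : Set (Measure (Ξ × Ξ)) :=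
  {K | IsProbabilityMeasure K ∧ K.map Prod.fst = P₁ ∧ K.map Prod.snd = P₂}

/-- The `L₁`-Wasserstein (Kantorovich) distance of two probability measures on a subset `Ξ` of a
normed space: the infimal transport cost over all couplings, with values in `[0, ∞]`. -/
def wasserstein {E : Type*} [NormedAddCommGroup E] {Ξ : Set E} [MeasurableSpace Ξ]
    (P₁ P₂ : Measure Ξ) : ℝ≥0∞ :=
  ⨅ K ∈ couplings P₁ P₂, ∫⁻ z, ENNReal.ofReal ‖(z.1 : E) - (z.2 : E)‖ ∂K

/-- The empirical distribution `(1/N) ∑ δ_{ξⁱ}` of `N` samples. -/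
def empirical {Ξ : Type*} [MeasurableSpace Ξ] {N : ℕ} (ξ : Fin N → Ξ) : Measure Ξ :=
  (N : ℝ≥0∞)⁻¹ • ∑ i, Measure.dirac (ξ i)

/-- The Wasserstein ball of radius `ρ` around the empirical distribution of the samples. -/
def ambiguitySet {E : Type*} [NormedAddCommGroup E] {Ξ : Set E} [MeasurableSpace Ξ]
    {N : ℕ} (ξ : Fin N → Ξ) (ρ : ℝ) : Set (Measure Ξ) :=
  {P | IsProbabilityMeasure P ∧ ((wasserstein P (empirical ξ) : ℝ≥0∞) : EReal) ≤ (ρ : EReal)}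

/-- The expectation `E_P[g]` with values in `[-∞, ∞]`, as the expectation of the positive part
minus that of the negative part (`∞ - ∞` is `-∞` in `EReal`). -/
def expectation {Ξ : Type*} [MeasurableSpace Ξ] (P : Measure Ξ) (g : Ξ → ℝ) : EReal :=
  ((∫⁻ s, ENNReal.ofReal (g s) ∂P : ℝ≥0∞) : EReal) -
    ((∫⁻ s, ENNReal.ofReal (-g s) ∂P : ℝ≥0∞) : EReal)

section Problems

variable {n N : ℕ} {E : Type*} [NormedAddCommGroup E] {Ξ : Set E}

/-- The objective of (D³RO): `f(x) + sup_P E_P[h(x, ·)]`, the supremum being taken over the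
decision dependent Wasserstein ball of radius `r(x)`. -/
def objective [MeasurableSpace Ξ] (f r : EuclideanSpace ℝ (Fin n) → ℝ)
    (h : EuclideanSpace ℝ (Fin n) → Ξ → ℝ) (ξ : Fin N → Ξ) (x : EuclideanSpace ℝ (Fin n)) :
    EReal :=
  (f x : EReal) + ⨆ P ∈ ambiguitySet ξ (r x), expectation P (h x)

/-- The optimal value of (D³RO). -/
def value [MeasurableSpace Ξ] (X : Set (EuclideanSpace ℝ (Fin n)))
    (f r : EuclideanSpace ℝ (Fin n) → ℝ) (h : EuclideanSpace ℝ (Fin n) → Ξ → ℝ)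
    (ξ : Fin N → Ξ) : EReal :=
  ⨅ x ∈ X, objective f r h ξ x

/-- `x` is an optimal solution of (D³RO) (with an optimal value that is not `+∞`). -/
def IsSolution [MeasurableSpace Ξ] (X : Set (EuclideanSpace ℝ (Fin n)))
    (f r : EuclideanSpace ℝ (Fin n) → ℝ) (h : EuclideanSpace ℝ (Fin n) → Ξ → ℝ)
    (ξ : Fin N → Ξ) (x : EuclideanSpace ℝ (Fin n)) : Prop :=
  x ∈ X ∧ objective f r h ξ x < ⊤ ∧ ∀ y ∈ X, objective f r h ξ x ≤ objective f r h ξ y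

/-- The feasible set of the semi-infinite program. The entries `v_1, …, v_N` are
`v i.castSucc` for `i : Fin N`, and `v_{N+1}` is `v (Fin.last N)`. -/
def sipFeasible (X : Set (EuclideanSpace ℝ (Fin n))) (h : EuclideanSpace ℝ (Fin n) → Ξ → ℝ)
    (ξ : Fin N → Ξ) : Set (EuclideanSpace ℝ (Fin n) × (Fin (N + 1) → ℝ)) :=
  {p | p.1 ∈ X ∧ 0 ≤ p.2 (Fin.last N) ∧
    ∀ (s : Ξ) (i : Fin N),
      h p.1 s - p.2 i.castSucc - p.2 (Fin.last N) * ‖(s : E) - (ξ i : E)‖ ≤ 0}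

/-- The objective of the semi-infinite program. -/
def sipObjective (N : ℕ) (f r : EuclideanSpace ℝ (Fin n) → ℝ)
    (p : EuclideanSpace ℝ (Fin n) × (Fin (N + 1) → ℝ)) : ℝ :=
  f p.1 + (1 / (N : ℝ)) * ∑ i : Fin N, p.2 i.castSucc + r p.1 * p.2 (Fin.last N)

/-- The optimal value of the semi-infinite program (`+∞` if it is infeasible). -/
def sipValue (X : Set (EuclideanSpace ℝ (Fin n))) (f r : EuclideanSpace ℝ (Fin n) → ℝ)
    (h : EuclideanSpace ℝ (Fin n) → Ξ → ℝ) (ξ : Fin N → Ξ) : EReal :=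
  ⨅ p ∈ sipFeasible X h ξ, (sipObjective N f r p : EReal)

/-- `p = (x, v)` is an optimal solution of the semi-infinite program. -/
def IsSipSolution (X : Set (EuclideanSpace ℝ (Fin n))) (f r : EuclideanSpace ℝ (Fin n) → ℝ)
    (h : EuclideanSpace ℝ (Fin n) → Ξ → ℝ) (ξ : Fin N → Ξ)
    (p : EuclideanSpace ℝ (Fin n) × (Fin (N + 1) → ℝ)) : Prop :=
  p ∈ sipFeasible X h ξ ∧
    ∀ q ∈ sipFeasible X h ξ, sipObjective N f r p ≤ sipObjective N f r q

end Problems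

end D3RO

end

/-! For fixed `x`, minimizing over `v` in the semi-infinite program is the Lagrangian dual of the
worst-case expectation; all claims follow from equality of the two values for each `x`. Weak duality
(`expectation_le_of_feasible`): the lower envelope `φ(t) = min_i (a_i + l d(t, ξ^i))` satisfies
`g(s) ≤ φ(t) + l d(s, t)` and `φ(ξ^i) ≤ a_i`; integrate this against a nearly optimal coupling.
Strong duality for positive radius (`exists_feasible_of_expectation_le`): it suffices to test with
measures that move each atom `ξ^i` to a point `s_i`, and with mixtures of two such measures. The
unmoved configuration costs `0 < ρ`, so `exists_multiplier` separates in the plane of (cost, value)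
pairs and yields an attained `l`. The Lagrangian is then a sum of functions of the single `s_i`, and
its suprema `a_i` decouple. At radius zero there is no Slater point. Semicontinuity and linear
growth instead make `a_i = g(ξ^i) + ε` feasible for large `l`, giving equal values without
attainment. -/

namespace D3RO

/-! ### Scalar multipliers and separable suprema. -/

section Real

/-- A Lagrange multiplier for the problem of maximizing `e` subject to `c ≤ ρ` over mixtures of at
most two points, under Slater's condition. -/
theorem exists_multiplier {ι : Type*} {c e : ι → ℝ} {ρ V : ℝ} {i₀ : ι} (h₀ : c i₀ < ρ)
    (hV : ∀ i j θ, 0 ≤ θ → θ ≤ 1 → θ * c i + (1 - θ) * c j ≤ ρ →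
      θ * e i + (1 - θ) * e j ≤ V) :
    ∃ l, 0 ≤ l ∧ ∀ i, e i - l * c i ≤ V - l * ρ := by
  have hle : ∀ i, c i ≤ ρ → e i ≤ V := fun i hi => by
    simpa using hV i i 1 zero_le_one le_rfl (by simpa using hi)
  -- Points with `c i > ρ` bound `l` below and points with `c j < ρ` bound it above; inserting `0`
  -- forces `l ≥ 0`, and the Slater point makes the upper set nonempty.
  obtain ⟨l, hl₁, hl₂⟩ := exists_between_of_forall_le
    (s := insert 0 ((fun i => (e i - V) / (c i - ρ)) '' {i | ρ < c i}))
    (t := (fun j => (V - e j) / (ρ - c j)) '' {j | c j < ρ})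
    (Set.insert_nonempty _ _) ⟨_, i₀, h₀, rfl⟩ (by
      rintro a (rfl | ⟨i, hi, rfl⟩) b ⟨j, hj, rfl⟩
      · exact div_nonneg (sub_nonneg.2 (hle j (le_of_lt hj))) (sub_nonneg.2 (le_of_lt hj))
      · have hi' : ρ < c i := hi
        have hj' : c j < ρ := hj
        have hd : 0 < c i - c j := by linarith
        -- This weight makes the mixed cost exactly `ρ`.
        have key := hV i j ((ρ - c j) / (c i - c j)) (div_nonneg (by linarith) hd.le)
          ((div_le_one hd).2 (by linarith)) (le_of_eq (by field_simp; ring))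
        have h1 : 1 - (ρ - c j) / (c i - c j) = (c i - ρ) / (c i - c j) := by
          field_simp; ring
        rw [h1, div_mul_eq_mul_div, div_mul_eq_mul_div, ← add_div, div_le_iff₀ hd] at key
        change (e i - V) / (c i - ρ) ≤ (V - e j) / (ρ - c j)
        rw [div_le_div_iff₀ (by linarith) (by linarith)]
        linarith)
  refine ⟨l, hl₁ (Set.mem_insert _ _), fun i => ?_⟩
  rcases lt_trichotomy (c i) ρ with hi | hi | hi
  · have := hl₂ ⟨i, hi, rfl⟩
    rw [le_div_iff₀ (by linarith)] at this
    linarith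
  · have := hle i hi.le
    rw [hi]; linarith
  · have := hl₁ (Set.mem_insert_of_mem _ ⟨i, hi, rfl⟩)
    rw [div_le_iff₀ (by linarith)] at this
    linarith

/-- If `∑ i, G i (s i) ≤ B` for every choice of the `s i`, then the suprema of the `G i` are finite
and their sum is at most `B`. -/
theorem exists_bounds_of_sum_le {ι T : Type*} [Fintype ι] [Nonempty ι] [Nonempty T]
    {G : ι → T → ℝ} {B : ℝ} (hB : ∀ s : ι → T, ∑ i, G i (s i) ≤ B) :
    ∃ a : ι → ℝ, (∀ i t, G i t ≤ a i) ∧ ∑ i, a i ≤ B := by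
  classical
  obtain ⟨t₀⟩ := ‹Nonempty T›
  have hbdd : ∀ i, BddAbove (Set.range (G i)) := fun i => by
    refine ⟨B - ∑ j ∈ Finset.univ.erase i, G j t₀, ?_⟩
    rintro _ ⟨t, rfl⟩
    have := hB (Function.update (fun _ => t₀) i t)
    rw [← Finset.add_sum_erase _ _ (Finset.mem_univ i), Function.update_self,
      Finset.sum_congr rfl (g := fun j => G j t₀)
        (fun j hj => by rw [Function.update_of_ne (Finset.ne_of_mem_erase hj)])] at this
    linarith
  have : Nonempty T := ⟨t₀⟩
  refine ⟨fun i => ⨆ t, G i t, fun i t => le_ciSup (hbdd i) t,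
    le_of_forall_pos_le_add fun ε hε => ?_⟩
  have hc : (0 : ℝ) < Fintype.card ι := by exact_mod_cast Fintype.card_pos
  have hex : ∀ i, ∃ t, (⨆ t, G i t) - ε / Fintype.card ι < G i t := fun i =>
    exists_lt_of_lt_ciSup (sub_lt_self _ (div_pos hε hc))
  choose s hs using hex
  have h1 := Finset.sum_le_sum fun i (_ : i ∈ Finset.univ) => (hs i).le
  rw [Finset.sum_sub_distrib, Finset.sum_const, Finset.card_univ, nsmul_eq_mul,
    mul_div_cancel₀ _ hc.ne'] at h1
  linarith [hB s]

end Real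

/-! ### Extended-real expectations. -/

section Expectation

variable {Ω Ω' : Type*} [MeasurableSpace Ω] [MeasurableSpace Ω']

theorem expectation_eq_integral {P : Measure Ω} {g : Ω → ℝ} (hg : Integrable g P) :
    expectation P g = ((∫ s, g s ∂P : ℝ) : EReal) := by
  have h1 : ∫⁻ s, ENNReal.ofReal (g s) ∂P ≠ ∞ := hg.lintegral_lt_top.ne
  have h2 : ∫⁻ s, ENNReal.ofReal (-g s) ∂P ≠ ∞ := hg.neg.lintegral_lt_top.ne
  rw [expectation, integral_eq_lintegral_pos_part_sub_lintegral_neg_part hg, EReal.coe_sub,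
    EReal.coe_ennreal_toReal h1, EReal.coe_ennreal_toReal h2]

theorem expectation_mono {P : Measure Ω} {g k : Ω → ℝ} (hgk : ∀ s, g s ≤ k s) :
    expectation P g ≤ expectation P k :=
  EReal.sub_le_sub
    (EReal.coe_ennreal_le_coe_ennreal_iff.2 <|
      lintegral_mono fun s => ENNReal.ofReal_le_ofReal (hgk s))
    (EReal.coe_ennreal_le_coe_ennreal_iff.2 <|
      lintegral_mono fun s => ENNReal.ofReal_le_ofReal (neg_le_neg (hgk s)))

theorem expectation_map {K : Measure Ω} {φ : Ω → Ω'} (hφ : Measurable φ) {g : Ω' → ℝ}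
    (hg : Measurable g) : expectation (K.map φ) g = expectation K (fun z => g (φ z)) := by
  rw [expectation, expectation, lintegral_map hg.ennreal_ofReal hφ,
    lintegral_map (f := fun t => ENNReal.ofReal (-g t)) hg.neg.ennreal_ofReal hφ]

end Expectation

/-! ### Empirical measures and their mixtures. -/

section Empirical

variable {Ω Ω' : Type*} [MeasurableSpace Ω] [MeasurableSpace Ω'] {N : ℕ}

theorem map_empirical {φ : Ω → Ω'} (hφ : Measurable φ) (s : Fin N → Ω) :
    (empirical s).map φ = empirical (fun i => φ (s i)) := by
  rw [empirical, Measure.map_smul, Measure.map_finset_sum hφ.aemeasurable]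
  simp_rw [Measure.map_dirac' hφ]
  rfl

theorem isProbabilityMeasure_empirical (hN : 0 < N) (s : Fin N → Ω) :
    IsProbabilityMeasure (empirical s) := by
  constructor
  simp [empirical, ENNReal.inv_mul_cancel (Nat.cast_ne_zero.2 hN.ne') (ENNReal.natCast_ne_top N)]

theorem integrable_empirical (hN : 0 < N) (s : Fin N → Ω) {g : Ω → ℝ} (hg : Measurable g) :
    Integrable g (empirical s) :=
  Integrable.smul_measure
    (integrable_finsetSum_measure.2 fun _ _ =>
      integrable_dirac' hg.stronglyMeasurable (by simp))
    (ENNReal.inv_ne_top.2 (Nat.cast_ne_zero.2 hN.ne'))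

theorem integral_empirical (s : Fin N → Ω) {g : Ω → ℝ} (hg : Measurable g) :
    ∫ t, g t ∂(empirical s) = 1 / (N : ℝ) * ∑ i, g (s i) := by
  rw [empirical, integral_smul_measure, integral_finsetSum_measure fun _ _ =>
      integrable_dirac' hg.stronglyMeasurable (by simp)]
  simp [integral_dirac' _ _ hg.stronglyMeasurable]

/-- The mixture of two empirical distributions with weights `θ` and `1 - θ`. -/
noncomputable def mixture (θ : ℝ) (s t : Fin N → Ω) : Measure Ω :=
  ENNReal.ofReal θ • empirical s + ENNReal.ofReal (1 - θ) • empirical t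

theorem map_mixture {φ : Ω → Ω'} (hφ : Measurable φ) (θ : ℝ) (s t : Fin N → Ω) :
    (mixture θ s t).map φ = mixture θ (fun i => φ (s i)) (fun i => φ (t i)) := by
  rw [mixture, Measure.map_add _ _ hφ, Measure.map_smul, Measure.map_smul, map_empirical hφ,
    map_empirical hφ, mixture]

theorem mixture_self {θ : ℝ} (h0 : 0 ≤ θ) (h1 : θ ≤ 1) (s : Fin N → Ω) :
    mixture θ s s = empirical s := by
  rw [mixture, ← add_smul, ← ENNReal.ofReal_add h0 (sub_nonneg.2 h1)]
  simp

theorem isProbabilityMeasure_mixture (hN : 0 < N) {θ : ℝ} (h0 : 0 ≤ θ) (h1 : θ ≤ 1)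
    (s t : Fin N → Ω) : IsProbabilityMeasure (mixture θ s t) := by
  have := isProbabilityMeasure_empirical hN s
  have := isProbabilityMeasure_empirical hN t
  constructor
  simp [mixture, ← ENNReal.ofReal_add h0 (sub_nonneg.2 h1)]

theorem integrable_mixture (hN : 0 < N) (θ : ℝ) (s t : Fin N → Ω) {g : Ω → ℝ}
    (hg : Measurable g) : Integrable g (mixture θ s t) :=
  ((integrable_empirical hN s hg).smul_measure ENNReal.ofReal_ne_top).add_measure
    ((integrable_empirical hN t hg).smul_measure ENNReal.ofReal_ne_top)

theorem integral_mixture (hN : 0 < N) {θ : ℝ} (h0 : 0 ≤ θ) (h1 : θ ≤ 1) (s t : Fin N → Ω)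
    {g : Ω → ℝ} (hg : Measurable g) :
    ∫ z, g z ∂(mixture θ s t) =
      θ * (1 / (N : ℝ) * ∑ i, g (s i)) + (1 - θ) * (1 / (N : ℝ) * ∑ i, g (t i)) := by
  rw [mixture, integral_add_measure
    ((integrable_empirical hN s hg).smul_measure ENNReal.ofReal_ne_top)
    ((integrable_empirical hN t hg).smul_measure ENNReal.ofReal_ne_top),
    integral_smul_measure, integral_smul_measure, integral_empirical s hg,
    integral_empirical t hg, ENNReal.toReal_ofReal h0, ENNReal.toReal_ofReal (sub_nonneg.2 h1)]
  rfl

end Empirical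

/-- An upper semicontinuous function of at most linear growth is, up to `ε`, bounded by its value at
a point plus a multiple of the distance to this point. -/
theorem exists_slope_of_upperSemicontinuousAt {E : Type*} [NormedAddCommGroup E] {Ξ : Set E}
    {g : Ξ → ℝ} {a : Ξ}
    (hg : UpperSemicontinuousAt g a) {C : ℝ} (hC : ∀ s : Ξ, g s ≤ C * (1 + ‖(s : E)‖))
    {ε : ℝ} (hε : 0 < ε) :
    ∃ l : ℝ, ∀ l' ≥ l, ∀ s : Ξ, g s ≤ g a + ε + l' * ‖(s : E) - (a : E)‖ := by
  obtain ⟨δ, hδ, hball⟩ := Metric.eventually_nhds_iff.1 (hg (g a + ε) (by linarith))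
  -- Outside the `δ`-ball, `|C|` absorbs the linear growth, and the quotient times a distance at
  -- least `δ` absorbs the constants.
  refine ⟨|C| + (|C| * (1 + ‖(a : E)‖) + |g a|) / δ, fun l' hl' s => ?_⟩
  have hq : 0 ≤ (|C| * (1 + ‖(a : E)‖) + |g a|) / δ := by positivity
  have hl0 : 0 ≤ l' := by linarith [abs_nonneg C]
  have hd : dist s a = ‖(s : E) - (a : E)‖ := by rw [Subtype.dist_eq, dist_eq_norm]
  rcases lt_or_ge (dist s a) δ with hs | hs
  · have := hball hs
    have h2 : 0 ≤ l' * ‖(s : E) - (a : E)‖ := by positivity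
    linarith
  · rw [hd] at hs
    have h1 : ‖(s : E)‖ ≤ ‖(a : E)‖ + ‖(s : E) - (a : E)‖ := norm_le_norm_add_norm_sub' _ _
    have h2 : C * (1 + ‖(s : E)‖) ≤ |C| * (1 + ‖(a : E)‖ + ‖(s : E) - (a : E)‖) :=
      (mul_le_mul_of_nonneg_right (le_abs_self C) (by positivity)).trans
        (mul_le_mul_of_nonneg_left (by linarith) (abs_nonneg C))
    have h3 := mul_le_mul_of_nonneg_right hl' (norm_nonneg ((s : E) - (a : E)))
    have h4 : |C| * (1 + ‖(a : E)‖) + |g a| ≤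
        (|C| * (1 + ‖(a : E)‖) + |g a|) / δ * ‖(s : E) - (a : E)‖ := by
      rw [div_mul_eq_mul_div, le_div_iff₀ hδ]
      exact mul_le_mul_of_nonneg_left hs (by positivity)
    have h5 := neg_abs_le (g a)
    linarith [hC s]

/-! ### Duality over the Wasserstein ball. -/

section Duality

variable {N : ℕ} {E : Type*} [NormedAddCommGroup E] {Ξ : Set E} [MeasurableSpace Ξ]
  [OpensMeasurableSpace Ξ]

theorem measurable_norm_sub_const (a : Ξ) : Measurable fun s : Ξ => ‖(s : E) - (a : E)‖ :=
  (continuous_subtype_val.sub continuous_const).norm.measurable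

/-- Second countability ensures that open sets of `Ξ × Ξ` are measurable for the product σ-algebra.
-/
theorem measurable_norm_sub [SecondCountableTopology E] :
    Measurable fun z : Ξ × Ξ => ‖(z.1 : E) - (z.2 : E)‖ :=
  ((continuous_subtype_val.comp continuous_fst).sub
    (continuous_subtype_val.comp continuous_snd)).norm.measurable

/-- Weak duality. -/
theorem expectation_le_of_feasible [SecondCountableTopology E] (hN : 0 < N) {ξ : Fin N → Ξ}
    {g : Ξ → ℝ} (hg : Measurable g) {ρ : ℝ} (hρ : 0 ≤ ρ) {P : Measure Ξ}
    (hP : P ∈ ambiguitySet ξ ρ) {a : Fin N → ℝ} {l : ℝ} (hl : 0 ≤ l)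
    (hfeas : ∀ (s : Ξ) (i : Fin N), g s ≤ a i + l * ‖(s : E) - (ξ i : E)‖) :
    expectation P g ≤ ((1 / (N : ℝ) * ∑ i, a i + ρ * l : ℝ) : EReal) := by
  have : Nonempty (Fin N) := ⟨⟨0, hN⟩⟩
  have hNr : (0 : ℝ) < N := by exact_mod_cast hN
  have hW : wasserstein P (empirical ξ) ≤ ENNReal.ofReal ρ := by
    rw [← EReal.coe_ennreal_le_coe_ennreal_iff, EReal.coe_ennreal_ofReal, max_eq_left hρ]
    exact hP.2
  let φ : Ξ → ℝ := fun t => ⨅ i, (a i + l * ‖(t : E) - (ξ i : E)‖)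
  have hφm : Measurable φ := Measurable.iInf fun i =>
    ((measurable_norm_sub_const (ξ i)).const_mul l).const_add (a i)
  have hφle : ∀ i, φ (ξ i) ≤ a i := fun i =>
    (ciInf_le (Set.finite_range _).bddBelow i).trans (by simp)
  have hgφ : ∀ s t : Ξ, g s ≤ φ t + l * ‖(s : E) - (t : E)‖ := fun s t => by
    rw [← sub_le_iff_le_add]
    refine le_ciInf fun i => ?_
    have htri := mul_le_mul_of_nonneg_left
      (norm_sub_le_norm_sub_add_norm_sub (s : E) (t : E) (ξ i : E)) hl
    linarith [hfeas s i]
  -- The slack `ε` avoids having to find an optimal coupling.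
  have hbound : ∀ ε : ℝ, 0 < ε →
      expectation P g ≤ ((1 / (N : ℝ) * ∑ i, a i + (ρ + ε) * l : ℝ) : EReal) := by
    intro ε hε
    have hlt : wasserstein P (empirical ξ) < ENNReal.ofReal (ρ + ε) :=
      hW.trans_lt ((ENNReal.ofReal_lt_ofReal_iff (by linarith)).2 (by linarith))
    simp only [wasserstein, iInf_lt_iff] at hlt
    obtain ⟨K, ⟨-, hK₁, hK₂⟩, hcost⟩ := hlt
    have hdi : Integrable (fun z : Ξ × Ξ => ‖(z.1 : E) - (z.2 : E)‖) K := by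
      refine ⟨measurable_norm_sub.aestronglyMeasurable, ?_⟩
      rw [hasFiniteIntegral_iff_ofReal (Filter.Eventually.of_forall fun z => norm_nonneg _)]
      exact hcost.trans ENNReal.ofReal_lt_top
    have hdle : ∫ z, ‖(z.1 : E) - (z.2 : E)‖ ∂K ≤ ρ + ε := by
      rw [← ENNReal.ofReal_le_ofReal_iff (by linarith),
        ofReal_integral_eq_lintegral_ofReal hdi (Filter.Eventually.of_forall fun z => norm_nonneg _)]
      exact hcost.le
    have hφi : Integrable (fun z : Ξ × Ξ => φ z.2) K := by
      have := integrable_empirical hN ξ hφm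
      rw [← hK₂] at this
      exact this.comp_measurable measurable_snd
    have hφint : ∫ z, φ z.2 ∂K = 1 / (N : ℝ) * ∑ i, φ (ξ i) := by
      rw [← integral_empirical ξ hφm, ← hK₂,
        integral_map measurable_snd.aemeasurable hφm.aestronglyMeasurable]
    rw [← hK₁, expectation_map measurable_fst hg]
    -- `g` need not be integrable, so the comparison is made in `EReal`; the upper bound is
    -- integrable.
    refine (expectation_mono fun z : Ξ × Ξ => hgφ z.1 z.2).trans ?_
    rw [expectation_eq_integral (g := fun z : Ξ × Ξ => φ z.2 + l * ‖(z.1 : E) - (z.2 : E)‖)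
        (hφi.add (hdi.const_mul l)), EReal.coe_le_coe_iff,
      integral_add hφi (hdi.const_mul l), integral_const_mul, hφint, mul_comm (ρ + ε)]
    exact add_le_add
      (mul_le_mul_of_nonneg_left (Finset.sum_le_sum fun i _ => hφle i) (by positivity))
      (mul_le_mul_of_nonneg_left hdle hl)
  rw [← EReal.le_of_forall_lt_iff_le]
  intro z hz
  rw [EReal.coe_lt_coe_iff] at hz
  -- Dividing by `l + 1` instead of `l` covers `l = 0`.
  have hl1 : 0 < l + 1 := by linarith
  refine (hbound ((z - (1 / (N : ℝ) * ∑ i, a i + ρ * l)) / (l + 1))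
    (div_pos (sub_pos.2 hz) hl1)).trans (EReal.coe_le_coe_iff.2 ?_)
  have : (z - (1 / (N : ℝ) * ∑ i, a i + ρ * l)) / (l + 1) * l ≤
      z - (1 / (N : ℝ) * ∑ i, a i + ρ * l) := by
    rw [div_mul_eq_mul_div, div_le_iff₀ hl1]
    nlinarith
  linarith

/-- Pair each moved atom with its origin `ξ i`: both components of the mixed coupling then have the
empirical measure as second marginal, and the transport cost is the left side of `hc`. -/
theorem mixture_mem_ambiguitySet [SecondCountableTopology E] (hN : 0 < N) {ξ : Fin N → Ξ}
    {ρ θ : ℝ} (h0 : 0 ≤ θ) (h1 : θ ≤ 1) (s t : Fin N → Ξ)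
    (hc : θ * (1 / (N : ℝ) * ∑ i, ‖(s i : E) - (ξ i : E)‖) +
      (1 - θ) * (1 / (N : ℝ) * ∑ i, ‖(t i : E) - (ξ i : E)‖) ≤ ρ) :
    mixture θ s t ∈ ambiguitySet ξ ρ := by
  refine ⟨isProbabilityMeasure_mixture hN h0 h1 s t, ?_⟩
  have hK : mixture θ (fun i => (s i, ξ i)) (fun i => (t i, ξ i)) ∈
      couplings (mixture θ s t) (empirical ξ) :=
    ⟨isProbabilityMeasure_mixture hN h0 h1 _ _, map_mixture measurable_fst _ _ _,
      (map_mixture measurable_snd _ _ _).trans (mixture_self h0 h1 ξ)⟩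
  have hle : wasserstein (mixture θ s t) (empirical ξ) ≤ ENNReal.ofReal ρ := by
    refine (iInf₂_le _ hK).trans ?_
    rw [← ofReal_integral_eq_lintegral_ofReal (integrable_mixture hN _ _ _ measurable_norm_sub)
        (Filter.Eventually.of_forall fun z => norm_nonneg _),
      integral_mixture hN h0 h1 _ _ measurable_norm_sub]
    exact ENNReal.ofReal_le_ofReal hc
  have hρ : 0 ≤ ρ := le_trans (by have := sub_nonneg.2 h1; positivity) hc
  rw [← EReal.coe_ennreal_le_coe_ennreal_iff, EReal.coe_ennreal_ofReal, max_eq_left hρ] at hle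
  exact hle

/-- Strong duality with dual attainment for a ball of positive radius. -/
theorem exists_feasible_of_expectation_le [SecondCountableTopology E] (hN : 0 < N)
    {ξ : Fin N → Ξ} {g : Ξ → ℝ} (hg : Measurable g) {ρ : ℝ} (hρ : 0 < ρ) {V : ℝ}
    (hV : ∀ P ∈ ambiguitySet ξ ρ, expectation P g ≤ V) :
    ∃ (a : Fin N → ℝ) (l : ℝ), 0 ≤ l ∧
      (∀ (s : Ξ) (i : Fin N), g s ≤ a i + l * ‖(s : E) - (ξ i : E)‖) ∧
      1 / (N : ℝ) * ∑ i, a i + ρ * l ≤ V := by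
  have : Nonempty (Fin N) := ⟨⟨0, hN⟩⟩
  have : Nonempty Ξ := ⟨ξ ⟨0, hN⟩⟩
  have hNr : (0 : ℝ) < N := by exact_mod_cast hN
  obtain ⟨l, hl, hmul⟩ := exists_multiplier (ι := Fin N → Ξ)
    (c := fun s => 1 / (N : ℝ) * ∑ i, ‖(s i : E) - (ξ i : E)‖)
    (e := fun s => 1 / (N : ℝ) * ∑ i, g (s i)) (ρ := ρ) (V := V) (i₀ := ξ)
    (by simpa using hρ) (fun s t θ h0 h1 hc => by
      have := hV _ (mixture_mem_ambiguitySet hN h0 h1 s t hc)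
      rwa [expectation_eq_integral (integrable_mixture hN _ _ _ hg),
        integral_mixture hN h0 h1 _ _ hg, EReal.coe_le_coe_iff] at this)
  -- Multiplied by `N`, the Lagrangian bound is separable in the points `s i`.
  obtain ⟨a, ha, hsum⟩ := exists_bounds_of_sum_le
    (G := fun i (s : Ξ) => g s - l * ‖(s : E) - (ξ i : E)‖) (B := N * (V - l * ρ)) (fun s => by
      have := hmul s
      rw [Finset.sum_sub_distrib, ← Finset.mul_sum, ← div_le_iff₀' hNr]
      refine le_trans (le_of_eq ?_) this
      ring)
  refine ⟨a, l, hl, fun s i => by linarith [ha i s], ?_⟩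
  rw [← div_le_iff₀' hNr] at hsum
  rw [one_div_mul_eq_div]
  linarith

/-- Strong duality for a ball of radius zero. -/
theorem exists_feasible_of_radius_zero [SecondCountableTopology E] (hN : 0 < N)
    {ξ : Fin N → Ξ} {g : Ξ → ℝ} (hg : Measurable g) {V : ℝ}
    (hV : ∀ P ∈ ambiguitySet ξ 0, expectation P g ≤ V)
    (husc : ∀ i, UpperSemicontinuousAt g (ξ i))
    {C : ℝ} (hC : ∀ s : Ξ, g s ≤ C * (1 + ‖(s : E)‖)) {ε : ℝ} (hε : 0 < ε) :
    ∃ (a : Fin N → ℝ) (l : ℝ), 0 ≤ l ∧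
      (∀ (s : Ξ) (i : Fin N), g s ≤ a i + l * ‖(s : E) - (ξ i : E)‖) ∧
      1 / (N : ℝ) * ∑ i, a i ≤ V + ε := by
  have hNr : (0 : ℝ) < N := by exact_mod_cast hN
  have hP := hV _ (mixture_mem_ambiguitySet hN zero_le_one le_rfl ξ ξ (by simp))
  rw [mixture_self zero_le_one le_rfl, expectation_eq_integral (integrable_empirical hN ξ hg),
    integral_empirical ξ hg, EReal.coe_le_coe_iff] at hP
  choose l hl using fun i => exists_slope_of_upperSemicontinuousAt (husc i) hC hε
  -- The sum of the `|l i|` is one nonnegative slope that dominates every `l i`.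
  refine ⟨fun i => g (ξ i) + ε, ∑ i, |l i|, Finset.sum_nonneg fun i _ => abs_nonneg _,
    fun s i => hl i _ ((le_abs_self _).trans
      (Finset.single_le_sum (f := fun i => |l i|) (fun j _ => abs_nonneg _)
        (Finset.mem_univ i))) s, ?_⟩
  rw [Finset.sum_add_distrib, mul_add]
  simp only [Finset.sum_const, Finset.card_univ, Fintype.card_fin, nsmul_eq_mul]
  rw [one_div, inv_mul_cancel_left₀ hNr.ne', ← one_div]
  linarith

end Duality

/-! ### From duality to the two optimization problems. -/

section Problems

variable {n N : ℕ} {E : Type*} [NormedAddCommGroup E] {Ξ : Set E}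
  {X : Set (EuclideanSpace ℝ (Fin n))} {f r : EuclideanSpace ℝ (Fin n) → ℝ}
  {h : EuclideanSpace ℝ (Fin n) → Ξ → ℝ} {ξ : Fin N → Ξ} {x : EuclideanSpace ℝ (Fin n)}

theorem snoc_mem_sipFeasible (hx : x ∈ X) {a : Fin N → ℝ} {l : ℝ} (hl : 0 ≤ l)
    (hfeas : ∀ (s : Ξ) (i : Fin N), h x s ≤ a i + l * ‖(s : E) - (ξ i : E)‖) :
    (x, (Fin.snoc a l : Fin (N + 1) → ℝ)) ∈ sipFeasible X h ξ := by
  refine ⟨hx, by simpa using hl, fun s i => ?_⟩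
  simp only [Fin.snoc_castSucc, Fin.snoc_last]
  linarith [hfeas s i]

theorem sipObjective_snoc (a : Fin N → ℝ) (l : ℝ) :
    sipObjective N f r (x, (Fin.snoc a l : Fin (N + 1) → ℝ)) =
      f x + (1 / (N : ℝ) * ∑ i, a i + r x * l) := by
  simp [sipObjective, add_assoc]

variable [MeasurableSpace Ξ]

theorem expectation_le_of_objective_le {z : ℝ} (hz : objective f r h ξ x ≤ z) :
    ∀ P ∈ ambiguitySet ξ (r x), expectation P (h x) ≤ ((z - f x : ℝ) : EReal) := by
  intro P hP
  have h1 : (f x : EReal) + expectation P (h x) ≤ z :=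
    (add_le_add_right (le_iSup₂ (f := fun P _ => expectation P (h x)) P hP) _).trans hz
  rw [EReal.coe_sub]
  exact EReal.le_sub_iff_add_le (Or.inl (EReal.coe_ne_bot _)) (Or.inl (EReal.coe_ne_top _)) |>.2
    (by rwa [add_comm])

variable [OpensMeasurableSpace Ξ] [SecondCountableTopology E]

theorem objective_le_sipObjective (hN : 0 < N) (hmeas : Measurable (h x)) (hr : 0 ≤ r x)
    {v : Fin (N + 1) → ℝ} (hv : (x, v) ∈ sipFeasible X h ξ) :
    objective f r h ξ x ≤ (sipObjective N f r (x, v) : EReal) := by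
  have hsup : ⨆ P ∈ ambiguitySet ξ (r x), expectation P (h x) ≤
      ((1 / (N : ℝ) * ∑ i : Fin N, v i.castSucc + r x * v (Fin.last N) : ℝ) : EReal) :=
    iSup₂_le fun P hP => expectation_le_of_feasible hN hmeas hr hP hv.2.1 fun s i => by
      linarith [hv.2.2 s i]
  refine (add_le_add_right hsup _).trans (le_of_eq ?_)
  rw [← EReal.coe_add]
  simp only [sipObjective, add_assoc]

/-- Dual attainment reaches the level `z` without slack; this is what later produces optimal
solutions of the semi-infinite program. -/
theorem exists_sipObjective_le_of_pos (hN : 0 < N) (hx : x ∈ X) (hmeas : Measurable (h x))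
    (hr : 0 < r x) {z : ℝ} (hz : objective f r h ξ x ≤ z) :
    ∃ v, (x, v) ∈ sipFeasible X h ξ ∧ sipObjective N f r (x, v) ≤ z := by
  obtain ⟨a, l, hl, hfeas, hle⟩ := exists_feasible_of_expectation_le hN hmeas hr
    (expectation_le_of_objective_le hz)
  refine ⟨Fin.snoc a l, snoc_mem_sipFeasible hx hl hfeas, ?_⟩
  rw [sipObjective_snoc]
  linarith

theorem exists_sipObjective_le_of_zero (hN : 0 < N) (hx : x ∈ X) (hmeas : Measurable (h x))
    (hr : r x = 0) (husc : ∀ i, UpperSemicontinuousAt (h x) (ξ i))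
    {C : ℝ} (hC : ∀ s : Ξ, h x s ≤ C * (1 + ‖(s : E)‖))
    {y z : ℝ} (hy : objective f r h ξ x ≤ y) (hyz : y < z) :
    ∃ v, (x, v) ∈ sipFeasible X h ξ ∧ sipObjective N f r (x, v) ≤ z := by
  have hV := expectation_le_of_objective_le hy
  rw [hr] at hV
  obtain ⟨a, l, hl, hfeas, hle⟩ :=
    exists_feasible_of_radius_zero hN hmeas hV husc hC (sub_pos.2 hyz)
  refine ⟨Fin.snoc a l, snoc_mem_sipFeasible hx hl hfeas, ?_⟩
  rw [sipObjective_snoc, hr]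
  linarith

/-- The empirical measure lies in the ball and integrates `h x` to a finite value. -/
theorem objective_ne_bot (hN : 0 < N) (hmeas : Measurable (h x)) (hr : 0 ≤ r x) :
    objective f r h ξ x ≠ ⊥ := by
  have hmem : mixture 1 ξ ξ ∈ ambiguitySet ξ (r x) :=
    mixture_mem_ambiguitySet hN zero_le_one le_rfl ξ ξ (by simpa using hr)
  have hle : (f x : EReal) + expectation (mixture 1 ξ ξ) (h x) ≤ objective f r h ξ x :=
    add_le_add_right (le_iSup₂ (f := fun P _ => expectation P (h x)) _ hmem) _
  rw [expectation_eq_integral (integrable_mixture hN _ _ _ hmeas), ← EReal.coe_add] at hle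
  exact ne_bot_of_le_ne_bot (EReal.coe_ne_bot _) hle

end Problems

end D3RO

theorem mainTheorem6 {n N : ℕ} (hN : 0 < N)
    {E : Type*} [NormedAddCommGroup E] [NormedSpace ℝ E] [FiniteDimensional ℝ E]
    {Ξ : Set E} [MeasurableSpace Ξ] [OpensMeasurableSpace Ξ]
    (X : Set (EuclideanSpace ℝ (Fin n)))
    (f r : EuclideanSpace ℝ (Fin n) → ℝ)
    (h : EuclideanSpace ℝ (Fin n) → Ξ → ℝ)
    (ξ : Fin N → Ξ)
    (hmeas : ∀ x ∈ X, Measurable (h x))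
    (hr : ∀ x ∈ X, 0 ≤ r x)
    (hr0 : ∀ x ∈ X, r x = 0 →
      (∀ i, UpperSemicontinuousAt (h x) (ξ i)) ∧
        ∃ C : ℝ, ∀ s : Ξ, h x s ≤ C * (1 + ‖(s : E)‖)) :
    D3RO.value X f r h ξ = D3RO.sipValue X f r h ξ ∧
    (∀ x ∈ X, D3RO.objective f r h ξ x =
      ⨅ v ∈ {v : Fin (N + 1) → ℝ | (x, v) ∈ D3RO.sipFeasible X h ξ},
        (D3RO.sipObjective N f r (x, v) : EReal)) ∧
    (∀ x v, D3RO.IsSipSolution X f r h ξ (x, v) → D3RO.IsSolution X f r h ξ x) ∧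
    (∀ x, 0 < r x → D3RO.IsSolution X f r h ξ x →
      ∃ v, D3RO.IsSipSolution X f r h ξ (x, v)) := by
  have : SecondCountableTopology E := by
    have := FiniteDimensional.proper ℝ E
    infer_instance
  have hweak : ∀ x v, (x, v) ∈ D3RO.sipFeasible X h ξ →
      D3RO.objective f r h ξ x ≤ (D3RO.sipObjective N f r (x, v) : EReal) := fun x v hv =>
    D3RO.objective_le_sipObjective hN (hmeas x hv.1) (hr x hv.1) hv
  have hobj : ∀ x ∈ X, D3RO.objective f r h ξ x =
      ⨅ v ∈ {v : Fin (N + 1) → ℝ | (x, v) ∈ D3RO.sipFeasible X h ξ},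
        (D3RO.sipObjective N f r (x, v) : EReal) := by
    intro x hx
    refine le_antisymm (le_iInf₂ fun v hv => hweak x v hv) ?_
    rw [← EReal.le_of_forall_lt_iff_le]
    intro z hz
    -- The intermediate real `y` supplies the slack `z - y` needed at radius zero.
    obtain ⟨y, hy, hyz⟩ := EReal.lt_iff_exists_real_btwn.1 hz
    obtain ⟨v, hv, hvz⟩ : ∃ v, (x, v) ∈ D3RO.sipFeasible X h ξ ∧
        D3RO.sipObjective N f r (x, v) ≤ z := by
      rcases (hr x hx).eq_or_lt with h0 | hpos
      · obtain ⟨husc, C, hC⟩ := hr0 x hx h0.symm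
        exact D3RO.exists_sipObjective_le_of_zero hN hx (hmeas x hx) h0.symm husc hC hy.le
          (EReal.coe_lt_coe_iff.1 hyz)
      · exact D3RO.exists_sipObjective_le_of_pos hN hx (hmeas x hx) hpos hz.le
    exact (iInf₂_le v hv).trans (EReal.coe_le_coe_iff.2 hvz)
  refine ⟨?_, hobj, ?_, ?_⟩
  · refine le_antisymm (le_iInf₂ fun p hp => (iInf₂_le p.1 hp.1).trans (hweak p.1 p.2 hp))
      (le_iInf₂ fun x hx => ?_)
    rw [hobj x hx]
    exact le_iInf₂ fun v hv => iInf₂_le (x, v) hv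
  · rintro x v ⟨hv, hopt⟩
    refine ⟨hv.1, (hweak x v hv).trans_lt (EReal.coe_lt_top _), fun y hy => ?_⟩
    rw [hobj y hy]
    exact le_iInf₂ fun w hw => (hweak x v hv).trans (EReal.coe_le_coe_iff.2 (hopt _ hw))
  · rintro x hpos ⟨hx, hfin, hopt⟩
    -- The optimal value is real, so it can itself serve as the level to be attained.
    have hcoe := EReal.coe_toReal hfin.ne
      (D3RO.objective_ne_bot (f := f) (ξ := ξ) hN (hmeas x hx) (hr x hx))
    obtain ⟨v, hv, hle⟩ := D3RO.exists_sipObjective_le_of_pos hN hx (hmeas x hx) hpos hcoe.ge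
    refine ⟨v, hv, fun q hq => ?_⟩
    rw [← EReal.coe_le_coe_iff]
    calc (D3RO.sipObjective N f r (x, v) : EReal) ≤ _ := EReal.coe_le_coe_iff.2 hle
      _ = D3RO.objective f r h ξ x := hcoe
      _ ≤ D3RO.objective f r h ξ q.1 := hopt q.1 hq.1
      _ ≤ _ := hweak q.1 q.2 hq
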